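/- Let $K$ be a field with $\operatorname{char} K \ne 2$, let $m$ and $n$ be nonnegative integers, and let $H = (H_1, \ldots, H_m) \in K[x_1, \ldots, x_n]^m$ be a quadratic homogeneous polynomial map, i.e. each component $H_i$ is homogeneous of degree $2$ (possibly zero). Let ${\mathcal J} H = (\partial H_i / \partial x_j)_{i,j}$ be its Jacobian matrix, and let $\operatorname{rk} {\mathcal J} H$ be the rank of this matrix over the field $K(x_1, \ldots, x_n)$. If $\operatorname{rk} {\mathcal J} H \le 3$, then $$\operatorname{rk} {\mathcal J} H = \operatorname{trdeg}_K K(H),$$ where $K(H) = K(H_1, \ldots, H_m) \subseteq K(x_1, \ldots, x_n)$ is the subfield generated over $K$ by the components of $H$, and $\operatorname{trdeg}_K$ denotes the transcendence degree over $K$. -/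

import Mathlib

noncomputable section

/-- The Jacobian matrix of a polynomial map `H = (H₁, …, Hₘ) ∈ K[x₁, …, xₙ]ᵐ`:
the `(i, j)` entry is the partial derivative of `H i` with respect to `x j`. -/
def jacobianMatrix {K : Type*} [Field K] {m n : ℕ}
    (H : Fin m → MvPolynomial (Fin n) K) :
    Matrix (Fin m) (Fin n) (MvPolynomial (Fin n) K) :=
  Matrix.of fun i j => MvPolynomial.pderiv j (H i)

/-- The field of rational functions `K(x₁, …, xₙ)`. -/
abbrev RationalFunctions (K : Type*) [Field K] (n : ℕ) : Type _ :=
  FractionRing (MvPolynomial (Fin n) K)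

/-- The rank of the Jacobian matrix of `H`, as a matrix over the field `K(x₁, …, xₙ)`. -/
def jacobianRank {K : Type*} [Field K] {m n : ℕ}
    (H : Fin m → MvPolynomial (Fin n) K) : ℕ :=
  ((jacobianMatrix H).map
    (algebraMap (MvPolynomial (Fin n) K) (RationalFunctions K n))).rank

/-- The subfield `K(H) = K(H₁, …, Hₘ)` of `K(x₁, …, xₙ)` generated by the components of `H`. -/
def fieldOfMap {K : Type*} [Field K] {m n : ℕ}
    (H : Fin m → MvPolynomial (Fin n) K) :
    IntermediateField K (RationalFunctions K n) :=
  IntermediateField.adjoin K (Set.range fun i =>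
    algebraMap (MvPolynomial (Fin n) K) (RationalFunctions K n) (H i))

end

/-! Rank ≤ trdeg is the characteristic-free half of the Jacobian criterion. If gradients are
independent at a point `a`, substitute `a + N X` with `N` a right inverse of the Jacobian at `a`. Up
to constants the `H i` become `X i` plus terms of order two, and such polynomials are algebraically
independent by Krull intersection (`algebraicIndependent_of_sub_X_mem_sq`).

For trdeg ≤ rank, suppose `H₀` and `r` forms `H i` are algebraically independent, the `∇ H i` are
linearly independent, and `∇ H₀ = ∑ f i ∇ H i`. Let `A₀`, `A i` be the constant Hessians, `F =
K(f)`, `Af = A₀ - ∑ f i A i`, so `Af x = 0`. Let `s = rk Af`, let the `l = n - s` columns of `B`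
span `ker Af`, and let `c` be the dimension of the `F`-span of the `Bᵀ (A i) B`. Then: - `c + s ≤
r`, by differentiating `Af x = 0` and `Af B = 0` (`rank_add_rank_le_of_mulVec_eq_zero`); - `trdeg F
+ l ≤ n`, since a generic point of `ker Af` determines `f` (`trdeg_add_le_of_pderiv_eq_sum`), so
`trdeg F ≤ s`; - writing `x = B t`, all `H i` lie in an `F`-space of dimension at most `c`, and so
does `H₀ = ∑ f i H i` (Euler), so `r + 1 ≤ trdeg F + c`. Together `r + 1 ≤ s + c ≤ r`, a
contradiction. Characteristic ≠ 2 lets a form be recovered from its Hessian. -/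

open MvPolynomial

universe u

/-! ### Derivations of fraction fields -/

/-- A derivation of a domain extends to its fraction field. -/
theorem exists_derivation_extending {K R L : Type*} [Field K] [CommRing R] [Algebra K R] [Field L]
    [Algebra R L] [IsFractionRing R L] [Algebra K L] [IsScalarTower K R L]
    (ψ : R →ₐ[K] TrivSqZeroExt L L) (hψ : ∀ p, (ψ p).fst = algebraMap R L p) :
    ∃ D : Derivation K L L, ∀ p, D (algebraMap R L p) = (ψ p).snd := by
  -- A dual number is a unit iff its first component is, so `ψ` lifts to the localization.
  have hu : ∀ y : nonZeroDivisors R, IsUnit ((ψ : R →+* TrivSqZeroExt L L) y) := by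
    intro y
    have : IsUnit (ψ y) := by
      rw [TrivSqZeroExt.isUnit_iff_isUnit_fst, hψ]
      exact IsLocalization.map_units L y
    exact this
  obtain ⟨Ψ, hΨ⟩ : ∃ Ψ : L →+* TrivSqZeroExt L L, ∀ p, Ψ (algebraMap R L p) = ψ p :=
    ⟨IsLocalization.lift hu, fun p => IsLocalization.lift_eq hu p⟩
  have hfst : ∀ a, (Ψ a).fst = a := by
    intro a
    have : ((TrivSqZeroExt.fstHom K L L) : TrivSqZeroExt L L →+* L).comp Ψ = RingHom.id L := by
      refine IsLocalization.ringHom_ext (nonZeroDivisors R) (RingHom.ext fun p => ?_)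
      change (Ψ (algebraMap R L p)).fst = _
      rw [hΨ, hψ]
      rfl
    exact DFunLike.congr_fun this a
  have hmul : ∀ a b : L, (Ψ (a * b)).snd = a • (Ψ b).snd + b • (Ψ a).snd := by
    intro a b
    rw [map_mul, TrivSqZeroExt.snd_mul, hfst, hfst, op_smul_eq_smul]
  have hK : ∀ c : K, (Ψ (algebraMap K L c)).snd = 0 := by
    intro c
    rw [IsScalarTower.algebraMap_apply K R L, hΨ, ψ.commutes]
    rfl
  let δ : L →ₗ[K] L :=
    { toFun := fun a => (Ψ a).snd
      map_add' := fun a b => by rw [map_add, TrivSqZeroExt.snd_add]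
      map_smul' := fun c a => by
        rw [Algebra.smul_def, hmul, hK, smul_zero, add_zero, RingHom.id_apply,
          algebraMap_smul] }
  refine ⟨Derivation.mk' δ hmul, fun p => ?_⟩
  change (Ψ _).snd = _
  rw [hΨ]

/-- A derivation of the fraction field of a polynomial ring, with prescribed values
on the variables. -/
theorem exists_derivation_fractionRing {K σ L : Type*} [Field K] [Field L]
    [Algebra (MvPolynomial σ K) L] [IsFractionRing (MvPolynomial σ K) L] [Algebra K L]
    [IsScalarTower K (MvPolynomial σ K) L] (d : σ → L) :
    ∃ D : Derivation K L L, ∀ v, D (algebraMap (MvPolynomial σ K) L (X v)) = d v := by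
  obtain ⟨ψ, hX⟩ : ∃ ψ : MvPolynomial σ K →ₐ[K] TrivSqZeroExt L L, ∀ v, ψ (X v) =
      TrivSqZeroExt.inl (algebraMap (MvPolynomial σ K) L (X v)) + TrivSqZeroExt.inr (d v) :=
    ⟨aeval _, fun v => aeval_X _ v⟩
  have hψ : ∀ p, (ψ p).fst = algebraMap (MvPolynomial σ K) L p := by
    intro p
    have : (TrivSqZeroExt.fstHom K L L).comp ψ = IsScalarTower.toAlgHom K _ L := by
      ext v
      simp [hX]
    exact DFunLike.congr_fun this p
  obtain ⟨D, hD⟩ := exists_derivation_extending ψ hψ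
  refine ⟨D, fun v => ?_⟩
  rw [hD, hX]
  simp

/-! ### Linear algebra and transcendence degree of generated fields -/

/-- `B` is a basis of the kernel and `C` a projection onto it in coordinates; `1 - B * C` kills `ker
A`, hence factors through `A`. If `A x = 0`, this gives `x = B (C x)`, also after field extension.
-/
theorem Matrix.exists_kernel_matrix {F : Type*} [Field F] {σ : Type*} [Fintype σ] [DecidableEq σ]
    (A : Matrix σ σ F) :
    ∃ (l : ℕ) (B : Matrix σ (Fin l) F) (C : Matrix (Fin l) σ F) (G : Matrix σ σ F),
      l + A.rank = Fintype.card σ ∧ A * B = 0 ∧ C * B = 1 ∧ B * C = 1 - G * A := by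
  let f := A.mulVecLin
  let b := Module.finBasis F (LinearMap.ker f)
  let β := (LinearMap.ker f).subtype ∘ₗ b.equivFun.symm.toLinearMap
  obtain ⟨p, hp⟩ := (LinearMap.ker f).subtype.exists_leftInverse_of_injective
    (LinearMap.ker_eq_bot.2 Subtype.val_injective)
  let γ := b.equivFun.toLinearMap ∘ₗ p
  obtain ⟨g, hg⟩ : ∃ g : (σ → F) →ₗ[F] (σ → F), g ∘ₗ f = LinearMap.id - β ∘ₗ γ := by
    have hk : LinearMap.ker f ≤ LinearMap.ker (LinearMap.id - β ∘ₗ γ) := by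
      intro v hv
      have : p v = ⟨v, hv⟩ := DFunLike.congr_fun hp ⟨v, hv⟩
      simp [β, γ, this]
    obtain ⟨g, hg⟩ := ((LinearMap.ker f).liftQ _ hk ∘ₗ
      f.quotKerEquivRange.symm.toLinearMap).exists_extend
    refine ⟨g, LinearMap.ext fun v => ?_⟩
    have := DFunLike.congr_fun hg ⟨f v, v, rfl⟩
    have h2 : f.quotKerEquivRange.symm ⟨f v, v, rfl⟩ = (LinearMap.ker f).mkQ v := by
      rw [LinearEquiv.symm_apply_eq]; rfl
    simpa [h2] using this
  refine ⟨_, LinearMap.toMatrix' β, LinearMap.toMatrix' γ, LinearMap.toMatrix' g, ?_, ?_, ?_, ?_⟩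
  · have := f.finrank_range_add_finrank_ker
    rw [Module.finrank_fintype_fun_eq_card] at this
    rw [Matrix.rank, add_comm]
    exact this
  · have hA : A = LinearMap.toMatrix' f := by simp [f, ← Matrix.toLin'_apply']
    rw [hA, ← LinearMap.toMatrix'_comp]
    have : f ∘ₗ β = 0 := by
      ext v
      simp [β]
    rw [this, map_zero]
  · rw [← LinearMap.toMatrix'_comp, ← LinearMap.toMatrix'_id]
    congr 1
    refine LinearMap.ext fun v => ?_
    have := DFunLike.congr_fun hp (b.equivFun.symm v)
    simp only [LinearMap.comp_apply, LinearMap.id_apply] at this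
    simp only [γ, β, LinearMap.comp_apply, LinearMap.id_apply]
    erw [this]
    exact b.equivFun.apply_symm_apply v
  · have hA : A = LinearMap.toMatrix' f := by simp [f, ← Matrix.toLin'_apply']
    rw [hA, ← LinearMap.toMatrix'_comp, ← LinearMap.toMatrix'_comp, hg, map_sub,
      LinearMap.toMatrix'_id, sub_sub_cancel]

theorem Matrix.exists_mul_eq_one_of_linearIndependent_row {F ι σ : Type*} [Field F] [Fintype ι]
    [DecidableEq ι] [Fintype σ] {J : Matrix ι σ F} (h : LinearIndependent F J.row) :
    ∃ N : Matrix σ ι F, J * N = 1 := by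
  have hr := h.rank_matrix
  rw [← Matrix.mulVec_surjective_iff_exists_right_inverse]
  have : LinearMap.range J.mulVecLin = ⊤ :=
    Submodule.eq_top_of_finrank_eq (by rw [Module.finrank_fintype_fun_eq_card]; exact hr)
  exact LinearMap.range_eq_top.1 this

/-- A maximal independent set of rows has a right inverse, an identity that survives `φ`. -/
theorem Matrix.rank_le_rank_map {F L ι σ : Type*} [Field F] [Field L] [Fintype ι] [Fintype σ]
    (A : Matrix ι σ F) (φ : F →+* L) : A.rank ≤ (A.map φ).rank := by
  classical
  obtain ⟨κ, a, ha, hspan, hli⟩ := exists_linearIndependent' F A.row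
  have : Fintype κ := Fintype.ofInjective a ha
  obtain ⟨N, hN⟩ := Matrix.exists_mul_eq_one_of_linearIndependent_row
    (J := A.submatrix a id) hli
  have h1 : A.rank = Fintype.card κ := by
    rw [Matrix.rank_eq_finrank_span_row, ← hspan]
    exact finrank_span_eq_card hli
  have h2 : (A.map φ).submatrix a id * N.map φ = 1 := by
    have := congrArg (fun M => M.map φ) hN
    simpa [Matrix.map_mul, Matrix.submatrix_map] using this
  have h3 := Matrix.rank_mul_le_left ((A.map φ).submatrix a id) (N.map φ)
  rw [h2, Matrix.rank_one] at h3
  rw [h1]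
  exact h3.trans (Matrix.rank_submatrix_le _ _ _)

open scoped IntermediateField.algebraAdjoinAdjoin in
theorem IntermediateField.trdeg_adjoin_le {K L : Type*} [Field K] [Field L] [Algebra K L]
    (s : Set L) : Algebra.trdeg K (IntermediateField.adjoin K s) ≤ Cardinal.mk s := by
  have h0 : Function.Surjective (aeval (R := K) (fun x : s => (x : L))).rangeRestrict :=
    AlgHom.rangeRestrict_surjective _
  have h1 := lift_trdeg_le_of_surjective _ h0
  rw [MvPolynomial.trdeg_of_isDomain] at h1
  have h2 := (Subalgebra.equivOfEq _ _ (Algebra.adjoin_eq_range K s)).trdeg_eq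
  rw [← h2] at h1
  have h3 := trdeg_add_eq (R := K) (S := Algebra.adjoin K s)
    (A := IntermediateField.adjoin K s)
  rw [trdeg_eq_zero (R := Algebra.adjoin K s), add_zero] at h3
  rw [← h3]
  simpa only [Cardinal.lift_umax, Cardinal.lift_lift, Cardinal.lift_le] using h1

/-! ### Jacobian criterion in arbitrary characteristic -/

/-- First order Taylor expansion of a polynomial. -/
theorem MvPolynomial.aeval_add_sub_mem_sq {K σ A : Type*} [CommRing K] [Fintype σ] [CommRing A]
    [Algebra K A] (I : Ideal A) (a d : σ → A) (hd : ∀ v, d v ∈ I) (p : MvPolynomial σ K) :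
    aeval (fun v => a v + d v) p - (aeval a p + ∑ v, d v * aeval a (pderiv v p)) ∈ I ^ 2 := by
  classical
  induction p using MvPolynomial.induction_on with
  | C c => simp
  | add p q hp hq =>
    have := add_mem hp hq
    simp only [map_add, mul_add, Finset.sum_add_distrib] at this ⊢
    convert this using 1
    ring
  | mul_X p u hp =>
    have hs : ∑ v, d v * aeval a (pderiv v p) ∈ I :=
      sum_mem fun v _ => I.mul_mem_right _ (hd v)
    have h1 := add_mem ((I ^ 2).mul_mem_right (a u + d u) hp)
      (pow_two I ▸ Ideal.mul_mem_mul hs (hd u))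
    have h2 : ∑ v, d v * aeval a (pderiv v (p * X u)) =
        (∑ v, d v * aeval a (pderiv v p)) * a u + aeval a p * d u := by
      simp only [Derivation.leibniz, pderiv_X, map_add, smul_eq_mul, map_mul, aeval_X, mul_add,
        Finset.sum_add_distrib]
      rw [add_comm, Finset.sum_mul]
      congr 1
      · exact Finset.sum_congr rfl fun v _ => by ring
      · rw [Finset.sum_eq_single u]
        · simp [mul_comm]
        · intro v _ hv
          simp [hv.symm]
        · simp
    convert h1 using 1
    rw [h2]
    simp only [map_mul, aeval_X]
    ring

/-- Polynomials that agree with the variables to first order are algebraically independent. -/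
theorem MvPolynomial.algebraicIndependent_of_sub_X_mem_sq {L ι : Type*} [Field L] [Finite ι]
    (y : ι → MvPolynomial ι L)
    (hy : ∀ i, y i - X i ∈ (Ideal.span (Set.range (X : ι → MvPolynomial ι L))) ^ 2) :
    AlgebraicIndependent L y := by
  set m := Ideal.span (Set.range (X : ι → MvPolynomial ι L)) with hm
  have hX : ∀ i, X i ∈ m := fun i => Ideal.subset_span ⟨i, rfl⟩
  have hsq : m ^ 2 ≤ m := Ideal.pow_le_self two_ne_zero
  have h0 : ∀ p, aeval y p - p ∈ m := by
    intro p
    induction p using MvPolynomial.induction_on with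
    | C c => simp [MvPolynomial.algebraMap_eq]
    | add p q hp hq =>
      convert add_mem hp hq using 1
      simp only [map_add]
      ring
    | mul_X p i hp =>
      convert add_mem (m.mul_mem_right (y i) hp) (m.mul_mem_left p (hsq (hy i))) using 1
      simp only [map_mul, aeval_X]
      ring
  have h1 : ∀ p ∈ m, aeval y p - p ∈ m ^ 2 := by
    intro p hp
    refine Submodule.span_induction ?_ ?_ ?_ ?_ hp
    · rintro _ ⟨i, rfl⟩
      simpa using hy i
    · simp
    · intro p q _ _ hp hq
      convert add_mem hp hq using 1
      simp only [map_add]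
      ring
    · intro c p hp' hp
      have hmem : (aeval y c - c) * p ∈ m ^ 2 := pow_two m ▸ Ideal.mul_mem_mul (h0 c) hp'
      convert add_mem ((m ^ 2).mul_mem_left (aeval y c) hp) hmem using 1
      simp only [smul_eq_mul, map_mul]
      ring
  -- Substituting `y` induces the identity on each graded piece `m ^ d / m ^ (d + 1)`.
  have h2 : ∀ d : ℕ, ∀ p ∈ m ^ d, aeval y p - p ∈ m ^ (d + 1) := by
    intro d
    induction d with
    | zero => intro p _; simpa using h0 p
    | succ d ih =>
      intro p hp
      rw [pow_succ] at hp
      refine Submodule.mul_induction_on hp ?_ ?_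
      · intro p hp q hq
        have hyq : aeval y q ∈ m := by
          have := add_mem (h0 q) hq
          simpa using this
        have e1 : (aeval y p - p) * aeval y q ∈ m ^ (d + 1 + 1) :=
          pow_succ m (d + 1) ▸ Ideal.mul_mem_mul (ih p hp) hyq
        have e2 : p * (aeval y q - q) ∈ m ^ (d + 1 + 1) :=
          pow_add m d 2 ▸ Ideal.mul_mem_mul hp (h1 q hq)
        convert add_mem e1 e2 using 1
        simp only [map_mul]
        ring
      · intro p q hp hq
        convert add_mem hp hq using 1
        simp only [map_add]
        ring
  rw [algebraicIndependent_iff]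
  intro p hp
  -- If `aeval y p = 0`, then `h2` pushes `p` from each power of `m` into the next.
  have h3 : ∀ d : ℕ, p ∈ m ^ d := by
    intro d
    induction d with
    | zero => simp
    | succ d ih =>
      have := h2 d p ih
      rw [hp, zero_sub] at this
      exact neg_mem_iff.1 this
  have hne : m ≠ ⊤ := by
    have hle : m ≤ RingHom.ker (aeval (R := L) (fun _ : ι => (0 : L))) := by
      rw [hm, Ideal.span_le]
      rintro _ ⟨i, rfl⟩
      simp
    intro h
    have : (1 : MvPolynomial ι L) ∈ RingHom.ker (aeval (R := L) (fun _ : ι => (0 : L))) :=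
      hle (h ▸ Submodule.mem_top)
    simp at this
  have h4 : p ∈ (⨅ d : ℕ, m ^ d) := (Submodule.mem_iInf _).2 h3
  rw [Ideal.iInf_pow_eq_bot_of_isDomain m hne] at h4
  simpa using h4

/-- If the gradients of polynomials are linearly independent at some point over an extension field,
then the polynomials are algebraically independent. -/
theorem MvPolynomial.algebraicIndependent_of_linearIndependent_pderiv {K L ι σ : Type*} [Field K]
    [Field L] [Algebra K L] [Fintype ι] [Fintype σ] (H : ι → MvPolynomial σ K) (a : σ → L)
    (h : LinearIndependent L (fun i => fun v => aeval a (pderiv v (H i)))) :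
    AlgebraicIndependent K H := by
  classical
  obtain ⟨N, hN⟩ := Matrix.exists_mul_eq_one_of_linearIndependent_row
    (J := Matrix.of fun i v => aeval a (pderiv v (H i))) h
  set m := Ideal.span (Set.range (X : ι → MvPolynomial ι L)) with hm
  -- Displacement along the right inverse `N`: the linear part of `H i` at `a` becomes exactly `X
  -- i`.
  let d : σ → MvPolynomial ι L := fun v => ∑ j, C (N v j) * X j
  have hd : ∀ v, d v ∈ m := fun v =>
    sum_mem fun j _ => m.mul_mem_left _ (Ideal.subset_span ⟨j, rfl⟩)
  let ψ : MvPolynomial σ K →ₐ[K] MvPolynomial ι L := aeval fun v => C (a v) + d v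
  have hC : ∀ p : MvPolynomial σ K, aeval (fun v => (C (a v) : MvPolynomial ι L)) p =
      C (aeval a p) := by
    intro p
    exact (aeval_algebraMap_apply (MvPolynomial ι L) a p)
  let y : ι → MvPolynomial ι L := fun i => ψ (H i) - C (aeval a (H i))
  have hy : AlgebraicIndependent L y := by
    refine algebraicIndependent_of_sub_X_mem_sq y fun i => ?_
    have h1 := aeval_add_sub_mem_sq m (fun v => C (a v)) d hd (H i)
    have h2 : ∑ v, d v * aeval (fun v => (C (a v) : MvPolynomial ι L)) (pderiv v (H i)) = X i := by
      simp only [hC, d, Finset.sum_mul]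
      rw [Finset.sum_comm]
      have : ∀ j, ∑ v, C (N v j) * X j * C (aeval a (pderiv v (H i))) =
          C ((1 : Matrix ι ι L) i j) * (X j : MvPolynomial ι L) := by
        intro j
        rw [← hN, Matrix.mul_apply, map_sum, Finset.sum_mul]
        refine Finset.sum_congr rfl fun v _ => ?_
        rw [Matrix.of_apply, map_mul]
        ring
      rw [Finset.sum_congr rfl fun j _ => this j]
      simp [Matrix.one_apply]
    rw [h2, hC] at h1
    convert h1 using 1
    simp only [y, ψ]
    ring
  have hψ : AlgebraicIndependent K (fun i => ψ (H i)) := by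
    have hs : AlgebraicIndependent L (fun i => ψ (H i)) := by
      rw [algebraicIndependent_iff]
      intro p hp
      obtain ⟨c, hc⟩ : ∃ c : ι → L, ∀ i, ψ (H i) = y i + C (c i) :=
        ⟨fun i => aeval a (H i), fun i => (sub_add_cancel _ _).symm⟩
      simp_rw [hc] at hp
      clear_value y
      have h1 : aeval y (aeval (fun i => (X i + C (c i) : MvPolynomial ι L)) p) = 0 := by
        rw [← hp, ← AlgHom.comp_apply]
        congr 1
        ext1 i
        simp [← algebraMap_eq]
      have h2 := hy.eq_zero_of_aeval_eq_zero _ h1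
      have h3 : aeval (fun i => (X i - C (c i) : MvPolynomial ι L))
          (aeval (fun i => (X i + C (c i) : MvPolynomial ι L)) p) = p := by
        rw [← AlgHom.comp_apply]
        conv_rhs => rw [← AlgHom.id_apply (R := L) p]
        congr 1
        ext1 i
        simp [algebraMap_eq]
      rw [← h3, h2, map_zero]
    exact hs.restrictScalars (algebraMap K L).injective
  exact AlgebraicIndependent.of_comp ψ hψ

/-! ### Hessians and the differentiated gradient relation -/

theorem Derivation.map_matrix_mul {K L m n o : Type*} [CommRing K] [CommRing L] [Algebra K L]
    [Fintype n] (D : Derivation K L L) (M : Matrix m n L) (N : Matrix n o L) :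
    (M * N).map D = M.map D * N + M * N.map D := by
  ext i j
  simp only [Matrix.map_apply, Matrix.mul_apply, Matrix.add_apply, map_sum, Derivation.leibniz,
    smul_eq_mul, ← Finset.sum_add_distrib]
  exact Finset.sum_congr rfl fun k _ => by ring

/-- A quadratic form is described by its constant Hessian matrix. -/
theorem MvPolynomial.IsHomogeneous.exists_hessian {K σ : Type*} [CommRing K] [Fintype σ]
    {H : MvPolynomial σ K} (hH : H.IsHomogeneous 2) :
    ∃ A : Matrix σ σ K, A.transpose = A ∧ (∀ u, pderiv u H = ∑ v, C (A u v) * X v) ∧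
      2 * H = ∑ u, X u * ∑ v, C (A u v) * X v := by
  have h1 : ∀ u v, pderiv v (pderiv u H) = C (coeff 0 (pderiv v (pderiv u H))) := by
    intro u v
    have : (pderiv v (pderiv u H)).IsHomogeneous 0 := hH.pderiv.pderiv
    exact totalDegree_eq_zero_iff_eq_C.1 ((totalDegree_zero_iff_isHomogeneous σ).2 this)
  have h2 : ∀ u, pderiv u H = ∑ v, C (coeff 0 (pderiv v (pderiv u H))) * X v := by
    intro u
    have h3 : (pderiv u H).IsHomogeneous 1 := hH.pderiv
    have h4 := h3.sum_X_mul_pderiv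
    rw [one_smul] at h4
    conv_lhs => rw [← h4]
    refine Finset.sum_congr rfl fun v _ => ?_
    rw [← h1, mul_comm]
  refine ⟨Matrix.of fun u v => coeff 0 (pderiv v (pderiv u H)), ?_, h2, ?_⟩
  · ext u v
    simp only [Matrix.transpose_apply, Matrix.of_apply]
    congr 1
    have h5 : ⁅pderiv (R := K) u, pderiv (R := K) v⁆ = (0 : Derivation K (MvPolynomial σ K) _) := by
      classical
      refine MvPolynomial.derivation_ext fun w => ?_
      simp only [Derivation.commutator_apply, pderiv_X, Derivation.coe_zero, Pi.zero_apply]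
      by_cases hw : w = v <;> by_cases hw' : w = u <;> simp [Pi.single_apply, hw, hw'] <;>
        split_ifs <;> simp
    have := DFunLike.congr_fun h5 H
    rw [Derivation.commutator_apply] at this
    exact sub_eq_zero.1 this
  · have := hH.sum_X_mul_pderiv
    rw [two_nsmul, ← two_mul] at this
    rw [← this]
    exact Finset.sum_congr rfl fun u _ => by rw [h2 u]; rfl

/-- The rank estimate obtained by differentiating a relation `(A₀ - ∑ fᵢ Aᵢ) x = 0` between
gradients of quadratic forms. -/
theorem rank_add_rank_le_of_mulVec_eq_zero {K F L ι σ τ : Type*} [Field K] [Field F] [Field L]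
    [Algebra K F] [Algebra F L] [Algebra K L] [IsScalarTower K F L] [Fintype ι] [Fintype σ]
    [DecidableEq σ] [Fintype τ] (A : ι → Matrix σ σ K) (A₀ : Matrix σ σ K)
    (hA : ∀ i, (A i).transpose = A i) (hA₀ : A₀.transpose = A₀) (f : ι → F) (x : σ → L)
    (D : σ → Derivation K L L) (hD : ∀ w v, D w (x v) = (1 : Matrix σ σ L) v w)
    (Af : Matrix σ σ F)
    (hAf : Af = A₀.map (algebraMap K F) - ∑ i, f i • (A i).map (algebraMap K F))
    (hx : (Af.map (algebraMap F L)).mulVec x = 0) (B : Matrix σ τ F) (hB : Af * B = 0) :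
    (Matrix.of fun i (p : τ × τ) =>
      (B.transpose * (A i).map (algebraMap K F) * B) p.1 p.2).rank + Af.rank ≤ Fintype.card ι := by
  set Cm := Matrix.of fun i (p : τ × τ) =>
      (B.transpose * (A i).map (algebraMap K F) * B) p.1 p.2 with hCm
  set φ := algebraMap F L with hφ
  let Ab := Af.map φ
  let Bb := B.map φ
  let Jf : Matrix ι σ L := Matrix.of fun i w => D w (φ (f i))
  let M : Matrix σ ι L := Matrix.of fun u i => ∑ v, algebraMap K L (A i u v) * x v
  have hAb : ∀ u v, Ab u v = algebraMap K L (A₀ u v) - ∑ i, φ (f i) * algebraMap K L (A i u v) := by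
    intro u v
    simp [Ab, hAf, hφ, Matrix.sum_apply, ← IsScalarTower.algebraMap_apply]
  have hDAb : ∀ w u v, D w (Ab u v) = - ∑ i, D w (φ (f i)) * algebraMap K L (A i u v) := by
    intro w u v
    rw [hAb]
    simp [mul_comm]
  have hsymm : Ab.transpose = Ab := by
    ext u v
    have e0 : A₀ v u = A₀ u v := congrFun (congrFun hA₀ u) v
    have e1 : ∀ i, A i v u = A i u v := fun i => congrFun (congrFun (hA i) u) v
    rw [Matrix.transpose_apply, hAb, hAb, e0]
    simp_rw [e1]
  have hABb : Ab * Bb = 0 := by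
    change Af.map φ * B.map φ = 0
    rw [← Matrix.map_mul, hB, Matrix.map_zero _ (map_zero φ)]
  have hBAb : Bb.transpose * Ab = 0 := by
    rw [← Matrix.transpose_transpose (Bb.transpose * Ab), Matrix.transpose_mul,
      Matrix.transpose_transpose, hsymm, hABb, Matrix.transpose_zero]
  -- Apply `D w` to `Ab x = 0`: column `w` of `Ab` equals `-(D w Ab) x`, a combination of the
  -- derivatives of the `f i`.
  have hM : Ab = M * Jf := by
    ext u w
    have h0 : ∑ v, Ab u v * x v = 0 := congrFun hx u
    have h1 := congrArg (D w) h0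
    simp only [map_sum, Derivation.leibniz, hD, hDAb, map_zero, smul_eq_mul,
      Finset.sum_add_distrib] at h1
    have h2 : ∑ v, Ab u v * (1 : Matrix σ σ L) v w = Ab u w := by
      rw [← Matrix.mul_apply, Matrix.mul_one]
    rw [h2, ← eq_neg_iff_add_eq_zero] at h1
    rw [h1, Matrix.mul_apply]
    simp only [M, Jf, Matrix.of_apply, mul_neg, Finset.sum_neg_distrib, neg_neg, Finset.mul_sum,
      Finset.sum_mul]
    rw [Finset.sum_comm]
    exact Finset.sum_congr rfl fun i _ => Finset.sum_congr rfl fun v _ => by ring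
  -- Apply `D w` to `Ab * Bb = 0` and multiply by `Bbᵀ` on the left. As `Ab` is symmetric, `Bbᵀ * Ab
  -- = 0`, leaving `Bbᵀ (D w Ab) Bb = 0`.
  have hC : (Cm.map φ).transpose * Jf = 0 := by
    ext p w
    let dA : Matrix σ σ L := Ab.map (D w)
    have h1 : dA * Bb = - (Ab * Bb.map (D w)) := by
      rw [eq_neg_iff_add_eq_zero, ← Derivation.map_matrix_mul, hABb,
        Matrix.map_zero _ (map_zero (D w))]
    have h2 : Bb.transpose * (dA * Bb) = 0 := by
      rw [h1, Matrix.mul_neg, ← Matrix.mul_assoc, hBAb, Matrix.zero_mul, neg_zero]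
    have h3 : dA = - ∑ i, D w (φ (f i)) • (A i).map (algebraMap K L) := by
      ext u v
      simp [dA, hDAb, Matrix.sum_apply]
    have h4 : ∀ i, φ (Cm i p) = (Bb.transpose * (A i).map (algebraMap K L) * Bb) p.1 p.2 := by
      intro i
      have : (B.transpose * (A i).map (algebraMap K F) * B).map φ =
          Bb.transpose * (A i).map (algebraMap K L) * Bb := by
        rw [Matrix.map_mul, Matrix.map_mul, Matrix.map_map, Matrix.transpose_map,
          IsScalarTower.algebraMap_eq K F L]
        rfl
      rw [← this]
      rfl
    rw [← Matrix.mul_assoc, h3, Matrix.mul_neg, Matrix.neg_mul, neg_eq_zero, Matrix.mul_sum,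
      Matrix.sum_mul] at h2
    have h5 := congrFun (congrFun h2 p.1) p.2
    rw [Matrix.sum_apply] at h5
    simp only [Matrix.mul_smul, Matrix.smul_mul, Matrix.smul_apply, smul_eq_mul] at h5
    rw [Matrix.mul_apply, Matrix.zero_apply]
    simp only [Matrix.zero_apply] at h5
    rw [← h5]
    refine Finset.sum_congr rfl fun i _ => ?_
    rw [Matrix.transpose_apply, Matrix.map_apply, h4, mul_comm]
    rfl
  have r1 := Matrix.rank_add_rank_le_card_of_mul_eq_zero hC
  rw [Matrix.rank_transpose] at r1
  have r2 := Cm.rank_le_rank_map φ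
  have r3 := Af.rank_le_rank_map φ
  have r4 : (Af.map φ).rank ≤ Jf.rank := by
    change Ab.rank ≤ _
    rw [hM]
    exact Matrix.rank_mul_le_right _ _
  omega

/-! ### Transcendence degree bounds -/

/-- If a polynomial ring over `F` is birationally generated over `K` by the images of
`card σ` variables, then `trdeg F` is at most `card σ` minus its number of variables. -/
theorem trdeg_add_le_of_birational {K F : Type u} [Field K] [Field F] [Algebra K F]
    {ι σ : Type} [Fintype σ] {l : ℕ} (f : ι → F)
    (hF : IntermediateField.adjoin K (Set.range f) = ⊤)
    (X' : σ → MvPolynomial (Fin l) F) (g : ι → MvPolynomial σ K) (h : MvPolynomial σ K)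
    (hne : aeval X' h ≠ 0) (hg : ∀ i, C (f i) * aeval X' h = aeval X' (g i))
    (c : Fin l → σ → F) (hc : ∀ j, X j = ∑ u, C (c j u) * X' u) :
    Algebra.trdeg K F + l ≤ Fintype.card σ := by
  let S := MvPolynomial (Fin l) F
  let E := FractionRing S
  let j := algebraMap S E
  -- `G = K(X')` contains `f`, hence `F`, hence each `X j`; so it is all of `E`, generated by `card
  -- σ` elements.
  let G : IntermediateField K E := IntermediateField.adjoin K (Set.range fun u => j (X' u))
  have hj : ∀ k : K, j (algebraMap K S k) = algebraMap K E k := fun k =>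
    (IsScalarTower.algebraMap_apply K S E k).symm
  have hev : ∀ p : MvPolynomial σ K, j (aeval X' p) ∈ G := by
    intro p
    induction p using MvPolynomial.induction_on with
    | C a =>
      rw [← algebraMap_eq, AlgHom.commutes, hj]
      exact G.algebraMap_mem a
    | add p q hp hq => rw [map_add, map_add]; exact add_mem hp hq
    | mul_X p u hp =>
      rw [map_mul, map_mul, aeval_X]
      exact mul_mem hp (IntermediateField.subset_adjoin _ _ ⟨u, rfl⟩)
  have hfG : ∀ i, j (C (f i)) ∈ G := by
    intro i
    have h1 : j (aeval X' h) ≠ 0 := by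
      rw [Ne, IsFractionRing.to_map_eq_zero_iff]
      exact hne
    have h2 : j (C (f i)) = j (aeval X' (g i)) / j (aeval X' h) := by
      rw [eq_div_iff h1, ← map_mul, hg]
    rw [h2]
    exact div_mem (hev _) (hev _)
  let κ : F →ₐ[K] E := IsScalarTower.toAlgHom K F E
  have hκ : ∀ a : F, κ a = j (C a) := fun a => IsScalarTower.algebraMap_apply F S E a
  have hFG : ∀ a : F, j (C a) ∈ G := by
    have h1 : IntermediateField.adjoin K (Set.range f) ≤ G.comap κ := by
      rw [IntermediateField.adjoin_le_iff]
      rintro _ ⟨i, rfl⟩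
      change κ (f i) ∈ G
      rw [hκ]
      exact hfG i
    intro a
    rw [hF] at h1
    rw [← hκ]
    exact h1 (IntermediateField.mem_top (x := a))
  have hS : ∀ p : S, j p ∈ G := by
    intro p
    induction p using MvPolynomial.induction_on with
    | C a => exact hFG a
    | add p q hp hq => rw [map_add]; exact add_mem hp hq
    | mul_X p i hp =>
      rw [map_mul]
      refine mul_mem hp ?_
      rw [hc, map_sum]
      refine sum_mem fun u _ => ?_
      rw [map_mul]
      exact mul_mem (hFG _) (IntermediateField.subset_adjoin _ _ ⟨u, rfl⟩)
  have hG : G = ⊤ := by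
    rw [eq_top_iff]
    intro e _
    obtain ⟨a, b, _, rfl⟩ := IsFractionRing.div_surjective (A := S) e
    exact div_mem (hS a) (hS b)
  have t1 : Algebra.trdeg K E ≤ Fintype.card σ := by
    have e1 : Algebra.trdeg K G = Algebra.trdeg K E := by
      rw [hG]
      exact IntermediateField.topEquiv.trdeg_eq
    rw [← e1]
    refine (IntermediateField.trdeg_adjoin_le _).trans ?_
    have := Cardinal.mk_range_le_lift (f := fun u => j (X' u))
    simpa using this
  have t2 : (l : Cardinal) ≤ Algebra.trdeg F E := by
    have h1 : AlgebraicIndependent F (fun i : Fin l => j (X i)) :=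
      (algebraicIndependent_X (Fin l) F).map' (f := IsScalarTower.toAlgHom F S E)
        (IsFractionRing.injective S E)
    simpa using h1.lift_cardinalMk_le_trdeg
  rw [← trdeg_add_eq K F] at t1
  exact (add_le_add_right t2 _).trans t1

theorem card_le_trdeg_add_of_mem_adjoin {K F L : Type u} [Field K] [Field F] [Field L]
    [Algebra K F] [Algebra F L] [Algebra K L] [IsScalarTower K F L] {κ : Type} [Fintype κ] {r : ℕ}
    (w : Fin r → L) (y : κ → L) (hy : AlgebraicIndependent K y)
    (hmem : ∀ k, y k ∈ IntermediateField.adjoin F (Set.range w)) :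
    (Fintype.card κ : Cardinal) ≤ Algebra.trdeg K F + r := by
  let T := IntermediateField.adjoin F (Set.range w)
  have h1 : AlgebraicIndependent K (fun k => (⟨y k, hmem k⟩ : T)) :=
    AlgebraicIndependent.of_comp (T.val.restrictScalars K) hy
  have h2 : (Fintype.card κ : Cardinal) ≤ Algebra.trdeg K T := by
    simpa using h1.lift_cardinalMk_le_trdeg
  have h3 : Algebra.trdeg F T ≤ r := by
    refine (IntermediateField.trdeg_adjoin_le _).trans ?_
    simpa using Cardinal.mk_range_le_lift (f := w)
  rw [← trdeg_add_eq K F (A := T)] at h2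
  exact h2.trans (add_le_add_right h3 _)

theorem sub_sum_smul_map_mulVec {K F Q ι σ : Type*} [Field K] [Field F] [CommRing Q]
    [Algebra K F] [Algebra F Q] [Algebra K Q] [IsScalarTower K F Q] [Fintype ι] [Fintype σ]
    (A : ι → Matrix σ σ K) (A₀ : Matrix σ σ K) (f : ι → F) (z : σ → Q) (u : σ) :
    ((A₀.map (algebraMap K F) - ∑ i, f i • (A i).map (algebraMap K F)).map
      (algebraMap F Q)).mulVec z u = ∑ v, algebraMap K Q (A₀ u v) * z v -
        ∑ i, algebraMap F Q (f i) * ∑ v, algebraMap K Q (A i u v) * z v := by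
  simp only [Matrix.mulVec, dotProduct, Matrix.map_apply, Matrix.sub_apply, Matrix.sum_apply,
    Matrix.smul_apply, map_sub, map_sum, smul_eq_mul, map_mul, sub_mul, Finset.sum_sub_distrib,
    ← IsScalarTower.algebraMap_apply, Finset.sum_mul, Finset.mul_sum]
  congr 1
  rw [Finset.sum_comm]
  exact Finset.sum_congr rfl fun i _ => Finset.sum_congr rfl fun v _ => by ring

/-- If the gradients of the quadratic forms `H i` are linearly independent with kernel relation
`∇ H₀ = ∑ f i ∇ (H i)`, the coefficient field `F = K(f)` and the kernel of
`A₀ - ∑ f i A i` satisfy a dimension bound. -/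
theorem trdeg_add_le_of_pderiv_eq_sum {K F L : Type u} [Field K] [Field F] [Field L]
    {ι σ : Type} [Fintype ι] [Fintype σ] [DecidableEq σ] [Algebra (MvPolynomial σ K) L]
    [IsFractionRing (MvPolynomial σ K) L] [Algebra K L] [IsScalarTower K (MvPolynomial σ K) L]
    [Algebra K F] [Algebra F L] [IsScalarTower K F L]
    (H : ι → MvPolynomial σ K) (H₀ : MvPolynomial σ K)
    (A : ι → Matrix σ σ K) (A₀ : Matrix σ σ K)
    (hA : ∀ i u, pderiv u (H i) = ∑ v, C (A i u v) * X v)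
    (hA₀ : ∀ u, pderiv u H₀ = ∑ v, C (A₀ u v) * X v)
    (hli : LinearIndependent L
      (fun i v => algebraMap (MvPolynomial σ K) L (pderiv v (H i))))
    (f : ι → F) (hF : IntermediateField.adjoin K (Set.range f) = ⊤)
    {l : ℕ} (B : Matrix σ (Fin l) F) (B' : Matrix (Fin l) σ F)
    (hAB : (A₀.map (algebraMap K F) - ∑ i, f i • (A i).map (algebraMap K F)) * B = 0)
    (hBB : B' * B = 1) (t : Fin l → L)
    (ht : (B.map (algebraMap F L)).mulVec t = fun v => algebraMap (MvPolynomial σ K) L (X v)) :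
    Algebra.trdeg K F + l ≤ Fintype.card σ := by
  classical
  let S := MvPolynomial (Fin l) F
  -- The generic point of the column space of `B`, which lies in the kernel.
  let X' : σ → S := (B.map (algebraMap F S)).mulVec X
  obtain ⟨N, hN⟩ := Matrix.exists_mul_eq_one_of_linearIndependent_row
    (J := Matrix.of fun i v => algebraMap (MvPolynomial σ K) L (pderiv v (H i))) hli
  -- `h` is a common denominator of the right inverse `N`. Then `h * f k` is the polynomial `∑ u,
  -- pderiv u H₀ * N' (u, k)`, both on `x` and on `X'`.
  obtain ⟨⟨h, hh⟩, hint⟩ := IsLocalization.exist_integer_multiples_of_finite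
    (nonZeroDivisors (MvPolynomial σ K)) (fun p : σ × ι => N p.1 p.2)
  choose N' hN' using hint
  have hR : ∀ i k, ∑ u, pderiv u (H i) * N' (u, k) = if i = k then h else 0 := by
    intro i k
    apply IsFractionRing.injective (MvPolynomial σ K) L
    have h1 := congrFun (congrFun hN i) k
    rw [Matrix.mul_apply] at h1
    simp only [map_sum, map_mul, hN']
    have h2 : algebraMap (MvPolynomial σ K) L (if i = k then h else 0) =
        algebraMap (MvPolynomial σ K) L h * (1 : Matrix ι ι L) i k := by
      rw [Matrix.one_apply]
      split_ifs <;> simp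
    rw [h2, ← h1, Finset.mul_sum]
    refine Finset.sum_congr rfl fun u _ => ?_
    simp only [Matrix.of_apply, Algebra.smul_def]
    ring
  have hev : ∀ (P : Matrix σ σ K) (u : σ),
      aeval X' (∑ v, C (P u v) * X v) = ∑ v, algebraMap K S (P u v) * X' v := by
    intro P u
    simp [← algebraMap_eq]
  have hS : ∀ u, aeval X' (pderiv u H₀) = ∑ i, C (f i) * aeval X' (pderiv u (H i)) := by
    intro u
    have h1 := sub_sum_smul_map_mulVec A A₀ f X' u
    have h2 : ((A₀.map (algebraMap K F) - ∑ i, f i • (A i).map (algebraMap K F)).map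
        (algebraMap F S)).mulVec X' = 0 := by
      rw [Matrix.mulVec_mulVec, ← Matrix.map_mul, hAB]
      simp
    rw [h2, Pi.zero_apply, eq_comm, sub_eq_zero] at h1
    rw [hA₀, hev, h1]
    refine Finset.sum_congr rfl fun i _ => ?_
    rw [hA, hev]
    rfl
  refine trdeg_add_le_of_birational f hF X' (fun k => ∑ u, pderiv u H₀ * N' (u, k)) h ?_ ?_ B' ?_
  -- Specializing `X` to `t` sends `X'` back to `x`, so `h` cannot vanish at `X'`.
  · have h1 : ((aeval t : S →ₐ[F] L).restrictScalars K).comp (aeval X') =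
        IsScalarTower.toAlgHom K (MvPolynomial σ K) L := by
      ext v
      have := congrFun ht v
      simp only [AlgHom.comp_apply, aeval_X, AlgHom.restrictScalars_apply,
        IsScalarTower.coe_toAlgHom']
      rw [← this]
      simp only [X', Matrix.mulVec, dotProduct, Matrix.map_apply, map_sum, map_mul, aeval_X]
      exact Finset.sum_congr rfl fun k _ => congrArg (· * t k) (aeval_C _ _)
    intro h0
    have h2 := DFunLike.congr_fun h1 h
    rw [AlgHom.comp_apply, h0, map_zero, IsScalarTower.coe_toAlgHom', eq_comm,
      IsFractionRing.to_map_eq_zero_iff] at h2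
    exact nonZeroDivisors.ne_zero hh h2
  · intro k
    have h1 : ∀ i, aeval X' (∑ u, pderiv u (H i) * N' (u, k)) =
        if i = k then aeval X' h else 0 := by
      intro i
      rw [hR]
      split_ifs <;> simp
    simp only [map_sum, map_mul] at h1 ⊢
    simp only [hS, Finset.sum_mul]
    rw [Finset.sum_comm]
    simp only [mul_assoc, ← Finset.mul_sum, h1]
    simp
  · intro j
    have h1 : (B'.map (algebraMap F S)).mulVec X' = X := by
      rw [Matrix.mulVec_mulVec, ← Matrix.map_mul, hBB]
      simp
    exact (congrFun h1 j).symm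

/-! ### Algebraic independence forces independent gradients -/

theorem Matrix.mulVec_dotProduct_mulVec_mulVec {R σ τ : Type*} [CommRing R] [Fintype σ]
    [Fintype τ] (P : Matrix σ σ R) (Q : Matrix σ τ R) (t : τ → R) :
    Q.mulVec t ⬝ᵥ P.mulVec (Q.mulVec t) = t ⬝ᵥ (Q.transpose * P * Q).mulVec t := by
  rw [← Matrix.mulVec_mulVec, ← Matrix.mulVec_mulVec, Matrix.dotProduct_mulVec t,
    Matrix.vecMul_transpose]

/-- Dimension count: `s1` bounds `c + s`, `s2` bounds `trdeg F + l`, and independence would give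
`s3`, which is one too many. -/
theorem not_algebraicIndependent_of_adjoin_eq_top {K F L : Type u} [Field K] [Field F] [Field L]
    (h2 : (2 : K) ≠ 0) {ι σ : Type} [Fintype ι] [Fintype σ] [DecidableEq σ]
    [Algebra (MvPolynomial σ K) L]
    [IsFractionRing (MvPolynomial σ K) L] [Algebra K L] [IsScalarTower K (MvPolynomial σ K) L]
    [Algebra K F] [Algebra F L] [IsScalarTower K F L]
    (H : ι → MvPolynomial σ K) (H₀ : MvPolynomial σ K)
    (hH : ∀ i, (H i).IsHomogeneous 2) (hH₀ : H₀.IsHomogeneous 2)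
    (hli : LinearIndependent L
      (fun i v => algebraMap (MvPolynomial σ K) L (pderiv v (H i))))
    (f : ι → F) (hF : IntermediateField.adjoin K (Set.range f) = ⊤)
    (hf : ∀ v, algebraMap (MvPolynomial σ K) L (pderiv v H₀) =
      ∑ i, algebraMap F L (f i) * algebraMap (MvPolynomial σ K) L (pderiv v (H i))) :
    ¬ AlgebraicIndependent K (fun o : Option ι => o.elim H₀ H) := by
  intro hind
  choose A hAs hAp hAe using fun i => (hH i).exists_hessian
  obtain ⟨A₀, hAs₀, hAp₀, hAe₀⟩ := hH₀.exists_hessian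
  have h2L : (2 : L) ≠ 0 := by
    have := (map_ne_zero (algebraMap K L)).2 h2
    rwa [map_ofNat] at this
  set j := algebraMap (MvPolynomial σ K) L with hj
  let x : σ → L := fun v => j (X v)
  have hjC : ∀ c, j (C c) = algebraMap K L c := fun c =>
    (IsScalarTower.algebraMap_apply K (MvPolynomial σ K) L c).symm
  have hjp : ∀ (P : Matrix σ σ K) u, j (∑ v, C (P u v) * X v) =
      ∑ v, algebraMap K L (P u v) * x v := by
    intro P u
    simp [x, hjC]
  let Af : Matrix σ σ F := A₀.map (algebraMap K F) - ∑ i, f i • (A i).map (algebraMap K F)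
  have hx : (Af.map (algebraMap F L)).mulVec x = 0 := by
    ext u
    rw [sub_sum_smul_map_mulVec, Pi.zero_apply, sub_eq_zero, ← hjp, ← hAp₀, hf]
    refine Finset.sum_congr rfl fun i _ => ?_
    rw [← hjp, ← hAp]
  obtain ⟨l, B, B', G, hl, hAB, hBB, hBG⟩ := Af.exists_kernel_matrix
  choose D hD using fun w => exists_derivation_fractionRing (K := K) (L := L)
    (fun v : σ => (1 : Matrix σ σ L) v w)
  have s1 := rank_add_rank_le_of_mulVec_eq_zero A A₀ hAs hAs₀ f x D hD Af rfl hx B hAB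
  set Cm := Matrix.of fun i (p : Fin l × Fin l) =>
      (B.transpose * (A i).map (algebraMap K F) * B) p.1 p.2 with hCm
  let t : Fin l → L := (B'.map (algebraMap F L)).mulVec x
  have ht : (B.map (algebraMap F L)).mulVec t = x := by
    have h1 : (B * B').map (algebraMap F L) =
        1 - G.map (algebraMap F L) * Af.map (algebraMap F L) := by
      rw [hBG, ← Matrix.map_mul, Matrix.map_sub _ (map_sub (algebraMap F L))]
      simp
    rw [Matrix.mulVec_mulVec, ← Matrix.map_mul, h1, Matrix.sub_mulVec, Matrix.one_mulVec,
      ← Matrix.mulVec_mulVec, hx, Matrix.mulVec_zero, sub_zero]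
  have s2 := trdeg_add_le_of_pderiv_eq_sum H H₀ A A₀ hAp hAp₀ hli f hF B B' hAB hBB t ht
  let Φ : (Fin l × Fin l → F) →ₗ[F] L :=
    Fintype.linearCombination F (fun p => 2⁻¹ * (t p.1 * t p.2))
  have hHΦ : ∀ i, j (H i) = Φ (Cm.row i) := by
    intro i
    have h3 : (2 : L) * j (H i) = ∑ p : Fin l × Fin l, Cm i p • (t p.1 * t p.2) := by
      have h4 : (2 : L) * j (H i) = dotProduct x (((A i).map (algebraMap K L)).mulVec x) := by
        have := congrArg j (hAe i)
        rw [map_mul, map_ofNat] at this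
        rw [this, map_sum]
        refine Finset.sum_congr rfl fun u _ => ?_
        rw [map_mul, hjp]
        rfl
      have h5 : (B.map (algebraMap F L)).transpose * (A i).map (algebraMap K L) *
          B.map (algebraMap F L) =
          (B.transpose * (A i).map (algebraMap K F) * B).map (algebraMap F L) := by
        rw [Matrix.map_mul, Matrix.map_mul, Matrix.map_map, Matrix.transpose_map,
          IsScalarTower.algebraMap_eq K F L]
        rfl
      rw [h4, ← ht, Matrix.mulVec_dotProduct_mulVec_mulVec, h5, Fintype.sum_prod_type]
      simp only [dotProduct, Matrix.mulVec, Finset.mul_sum]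
      refine Finset.sum_congr rfl fun a _ => Finset.sum_congr rfl fun b _ => ?_
      rw [Algebra.smul_def, Matrix.map_apply]
      simp only [hCm, Matrix.of_apply]
      ring
    apply mul_left_cancel₀ h2L
    rw [h3, Fintype.linearCombination_apply, Finset.mul_sum]
    refine Finset.sum_congr rfl fun p _ => ?_
    rw [mul_smul_comm, mul_inv_cancel_left₀ h2L]
    rfl
  -- Since `2 * H i = tᵀ (Bᵀ (A i) B) t`, linear relations among the rows of `Cm` pass to the `H i`.
  let V : Submodule F L := (Submodule.span F (Set.range Cm.row)).map Φ
  have hV : Module.finrank F V ≤ Cm.rank := by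
    rw [Matrix.rank_eq_finrank_span_row]
    exact Submodule.finrank_map_le _ _
  let b := Module.finBasis F V
  have hVT : ∀ v ∈ V, v ∈ IntermediateField.adjoin F (Set.range fun k => (b k : L)) := by
    intro v hv
    have := b.sum_repr ⟨v, hv⟩
    have h3 : _ = v := congrArg Subtype.val this
    rw [← h3]
    simp only [AddSubmonoidClass.coe_finsetSum, Submodule.coe_smul]
    exact sum_mem fun k _ => IntermediateField.smul_mem _
      (IntermediateField.subset_adjoin _ _ (Set.mem_range_self k))
  have hHT : ∀ i, j (H i) ∈ IntermediateField.adjoin F (Set.range fun k => (b k : L)) := by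
    intro i
    refine hVT _ ?_
    rw [hHΦ]
    exact Submodule.mem_map_of_mem (Submodule.subset_span ⟨i, rfl⟩)
  have hH₀f : j H₀ = ∑ i, f i • j (H i) := by
    apply mul_left_cancel₀ h2L
    have e : ∀ {Q : MvPolynomial σ K}, Q.IsHomogeneous 2 →
        2 * j Q = ∑ v, x v * j (pderiv v Q) := by
      intro Q hQ
      have := congrArg j hQ.sum_X_mul_pderiv
      rw [two_nsmul, ← two_mul, map_mul, map_ofNat] at this
      rw [← this, map_sum]
      exact Finset.sum_congr rfl fun v _ => map_mul _ _ _
    rw [e hH₀, Finset.mul_sum]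
    simp only [mul_smul_comm, e (hH _), hf, Finset.mul_sum, Finset.smul_sum]
    rw [Finset.sum_comm]
    refine Finset.sum_congr rfl fun i _ => Finset.sum_congr rfl fun v _ => ?_
    rw [Algebra.smul_def]
    ring
  have hind' : AlgebraicIndependent K (fun o : Option ι => j (o.elim H₀ H)) :=
    hind.map' (f := IsScalarTower.toAlgHom K (MvPolynomial σ K) L)
      (IsFractionRing.injective (MvPolynomial σ K) L)
  have s3 := card_le_trdeg_add_of_mem_adjoin (F := F) (fun k => (b k : L)) _ hind' (by
    rintro (_ | i)
    · change j H₀ ∈ _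
      rw [hH₀f]
      exact sum_mem fun i _ => IntermediateField.smul_mem _ (hHT i)
    · exact hHT i)
  rw [Fintype.card_option] at s3
  obtain ⟨d, hd⟩ : ∃ d : ℕ, Algebra.trdeg K F = d := by
    apply Cardinal.lt_aleph0.1
    exact lt_of_le_of_lt (le_self_add.trans s2) (Cardinal.natCast_lt_aleph0)
  rw [hd] at s2 s3
  have s2' : d + l ≤ Fintype.card σ := by exact_mod_cast s2
  have s3' : Fintype.card ι + 1 ≤ d + Module.finrank F V := by exact_mod_cast s3
  omega

/-- Algebraically independent quadratic forms have linearly independent gradients, in every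
characteristic other than two. No bound on the Jacobian rank is needed. -/
theorem linearIndependent_pderiv_of_algebraicIndependent {K L : Type u} [Field K] [Field L]
    (h2 : (2 : K) ≠ 0) {ι σ : Type} [Finite ι] [Fintype σ]
    [Algebra (MvPolynomial σ K) L]
    [IsFractionRing (MvPolynomial σ K) L] [Algebra K L] [IsScalarTower K (MvPolynomial σ K) L]
    (H : ι → MvPolynomial σ K) (hH : ∀ i, (H i).IsHomogeneous 2)
    (hind : AlgebraicIndependent K H) :
    LinearIndependent L (fun i v => algebraMap (MvPolynomial σ K) L (pderiv v (H i))) := by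
  classical
  set row : ι → σ → L := fun i v => algebraMap (MvPolynomial σ K) L (pderiv v (H i)) with hrow
  obtain ⟨κ, a, ha, hspan, hli⟩ := exists_linearIndependent' L row
  by_cases hsurj : Function.Surjective a
  · exact (linearIndependent_equiv (Equiv.ofBijective a ⟨ha, hsurj⟩)).1 hli
  · exfalso
    -- A row outside a maximal independent subfamily plays the role of `∇ H₀`.
    rw [Function.Surjective] at hsurj
    push Not at hsurj
    obtain ⟨i₀, hi₀⟩ := hsurj
    have : Finite κ := Finite.of_injective a ha
    have : Fintype κ := Fintype.ofFinite κ
    have hmem : row i₀ ∈ Submodule.span L (Set.range (row ∘ a)) := by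
      rw [hspan]
      exact Submodule.subset_span ⟨i₀, rfl⟩
    obtain ⟨f, hf⟩ := (Submodule.mem_span_range_iff_exists_fun L).1 hmem
    let F := IntermediateField.adjoin K (Set.range f)
    let f' : κ → F := fun k => ⟨f k, IntermediateField.subset_adjoin _ _ ⟨k, rfl⟩⟩
    have hF : IntermediateField.adjoin K (Set.range f') = ⊤ := by
      rw [eq_top_iff]
      have h1 : F ≤ (IntermediateField.adjoin K (Set.range f')).map F.val := by
        rw [IntermediateField.adjoin_le_iff]
        rintro _ ⟨k, rfl⟩
        exact ⟨f' k, IntermediateField.subset_adjoin _ _ ⟨k, rfl⟩, rfl⟩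
      intro c _
      obtain ⟨c', hc', h⟩ := h1 c.2
      have : c' = c := Subtype.ext h
      exact this ▸ hc'
    refine not_algebraicIndependent_of_adjoin_eq_top (F := F) (L := L) h2 (fun k => H (a k)) (H i₀)
      (fun k => hH _) (hH _) hli f' hF ?_ ?_
    · intro v
      have := congrFun hf v
      rw [Finset.sum_apply] at this
      exact this.symm
    · have hinj : Function.Injective (fun o : Option κ => o.elim i₀ a) := by
        rintro (_ | k) (_ | k') h
        · rfl
        · exact absurd h.symm (hi₀ k')
        · exact absurd h (hi₀ k)
        · exact congrArg some (ha h)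
      convert hind.comp _ hinj using 1
      ext1 o
      cases o <;> rfl

/-! ### Comparison of rank and transcendence degree -/

open scoped IntermediateField.algebraAdjoinAdjoin in
theorem IntermediateField.exists_fin_algebraicIndependent_trdeg_adjoin {K L : Type*} [Field K]
    [Field L] [Algebra K L] {ι : Type*} [Finite ι] (y : ι → L) :
    ∃ (k : ℕ) (c : Fin k → ι), AlgebraicIndependent K (y ∘ c) ∧
      Algebra.trdeg K (IntermediateField.adjoin K (Set.range y)) = k := by
  set S := Set.range y with hS
  let z : ι → Algebra.adjoin K S := fun i => ⟨y i, Algebra.subset_adjoin ⟨i, rfl⟩⟩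
  have htop : Algebra.adjoin K (Set.range z) = ⊤ := by
    have h1 : Set.range z = ((↑) : Algebra.adjoin K S → L) ⁻¹' S := by
      ext e
      constructor
      · rintro ⟨i, rfl⟩
        exact ⟨i, rfl⟩
      · rintro ⟨i, hi⟩
        exact ⟨i, Subtype.ext hi⟩
    rw [h1]
    exact Algebra.adjoin_adjoin_coe_preimage
  have halg : Algebra.IsAlgebraic (Algebra.adjoin K (Set.range z)) (Algebra.adjoin K S) :=
    ⟨fun e => isAlgebraic_algebraMap
      (⟨e, htop ▸ Algebra.mem_top⟩ : Algebra.adjoin K (Set.range z))⟩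
  -- The transcendence basis is drawn from the generators themselves, so it consists of components
  -- of the map.
  obtain ⟨t, hts, ht⟩ := exists_isTranscendenceBasis_subset (R := K) (Set.range z)
  have hfin : Finite t := ((Set.finite_range z).subset hts).to_subtype
  choose c hc using hts
  obtain ⟨k, ⟨e⟩⟩ := Finite.exists_equiv_fin t
  refine ⟨k, fun a => c (e.symm a).2, ?_, ?_⟩
  · have h1 := (ht.1.comp _ e.symm.injective).map' (f := (Algebra.adjoin K S).val)
      Subtype.val_injective
    convert h1 using 1
    ext1 a
    exact congrArg Subtype.val (hc (e.symm a).2)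
  · have h3 := trdeg_add_eq K (Algebra.adjoin K S) (A := IntermediateField.adjoin K S)
    rw [trdeg_eq_zero (R := Algebra.adjoin K S), add_zero] at h3
    rw [← h3, ← ht.cardinalMk_eq_trdeg]
    have : Fintype t := Fintype.ofEquiv _ e.symm
    rw [Cardinal.mk_fintype, Fintype.card_congr e, Fintype.card_fin]

theorem mainTheorem8 {K : Type*} [Field K] (hchar : ringChar K ≠ 2) {m n : ℕ}
    (H : Fin m → MvPolynomial (Fin n) K)
    (hquad : ∀ i, (H i).IsHomogeneous 2)
    (hrank : jacobianRank H ≤ 3) :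
    Algebra.trdeg K (fieldOfMap H) = (jacobianRank H : Cardinal) := by
  let φ := algebraMap (MvPolynomial (Fin n) K) (RationalFunctions K n)
  have hφ : Function.Injective φ := IsFractionRing.injective _ _
  let J := (jacobianMatrix H).map φ
  apply le_antisymm
  · obtain ⟨k, c, hind, hk⟩ :=
      IntermediateField.exists_fin_algebraicIndependent_trdeg_adjoin (K := K) (fun i => φ (H i))
    have h1 : AlgebraicIndependent K (H ∘ c) :=
      AlgebraicIndependent.of_comp (IsScalarTower.toAlgHom K _ (RationalFunctions K n)) hind
    have h2 : LinearIndependent (RationalFunctions K n) (J.submatrix c id).row :=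
      linearIndependent_pderiv_of_algebraicIndependent (Ring.two_ne_zero hchar) (H ∘ c)
        (fun _ => hquad _) h1
    have h3 : k ≤ J.rank := by
      have h4 := h2.rank_matrix
      rw [Fintype.card_fin] at h4
      exact h4 ▸ Matrix.rank_submatrix_le _ _ _
    exact hk.trans_le (by exact_mod_cast h3)
  · obtain ⟨κ, a, ha, hspan, hli⟩ := exists_linearIndependent' (RationalFunctions K n) J.row
    have : Fintype κ := Fintype.ofInjective a ha
    have h1 : jacobianRank H = Fintype.card κ := by
      change J.rank = _
      rw [Matrix.rank_eq_finrank_span_row, ← hspan]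
      exact finrank_span_eq_card hli
    have h2 : ∀ p, aeval (fun v => φ (X v)) p = φ p := by
      intro p
      have : aeval (fun v => φ (X v)) =
          IsScalarTower.toAlgHom K (MvPolynomial (Fin n) K) (RationalFunctions K n) := by
        ext v
        simp [φ]
      exact DFunLike.congr_fun this p
    -- The Jacobian criterion is applied at the generic point `x` of `K(x)`.
    have h3 : AlgebraicIndependent K (H ∘ a) := by
      refine MvPolynomial.algebraicIndependent_of_linearIndependent_pderiv (H ∘ a)
        (fun v => φ (X v)) ?_
      simp only [h2]
      exact hli
    have h4 : AlgebraicIndependent K (fun k => (⟨φ (H (a k)),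
        IntermediateField.subset_adjoin _ _ ⟨a k, rfl⟩⟩ : fieldOfMap H)) :=
      AlgebraicIndependent.of_comp (fieldOfMap H).val
        (h3.map' (f := IsScalarTower.toAlgHom K _ (RationalFunctions K n)) hφ)
    rw [h1]
    simpa using h4.lift_cardinalMk_le_trdeg
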